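/- **Conventions.** A function $f\colon\mathbb{R}^n\to\mathbb{R}\cup\{+\infty\}$ is lsc if it is lower semicontinuous. $\delta_Q$ is $0$ on the set $Q$ and $+\infty$ off it. Where $f(x)$ is finite, $\partial_p f(x)$ is the set of $v$ with $f(y)\ge f(x)+\langle v,y-x\rangle+O(|y-x|^2)$ as $y\to x$, and $\partial f(x)$ is the set of limits $v=\lim v_i$ with $v_i\in\partial_p f(x_i)$, $x_i\to x$, $f(x_i)\to f(x)$; both sets are empty where $f(x)=+\infty$. A set $\mathcal{M}\subset\mathbb{R}^n$ is a $C^3$ manifold around $\bar x\in\mathcal{M}$ if, on a neighborhood of $\bar x$, it is the zero set of a $C^3$ map $F\colon\mathbb{R}^n\to\mathbb{R}^m$ (some $m\ge 0$) whose derivative $\nabla F(\bar x)$ is surjective; then $T_{\mathcal{M}}(\bar x)=\ker\nabla F(\bar x)$. It is a $C^3$ identifiable manifold of $f$ at $\bar x\in\mathcal{M}$ for $\bar v\in\partial f(\bar x)$ if it is a $C^3$ manifold around $\bar x$, $f$ agrees on $\mathcal{M}$ near $\bar x$ with a real-valued $C^3$ function on $\mathbb{R}^n$, and, for all sequences $x_i\to\bar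 x$ with $f(x_i)\to f(\bar x)$ and $v_i\to\bar v$ with $v_i\in\partial f(x_i)$, one has $x_i\in\mathcal{M}$ for all large $i$. Where $f(\bar x)$ is finite, the subderivative is $$df(\bar x)(\bar u)=\liminf_{t\searrow 0,\;u\to\bar u}\frac{f(\bar x+tu)-f(\bar x)}{t},$$ and, where $df(\bar x)(\bar u)$ is finite as well, the parabolic subderivative is $$d^2f(\bar x)(\bar u|\bar w)=\liminf_{t\searrow 0,\;w\to\bar w}\frac{f(\bar x+t\bar u+\frac12t^2w)-f(\bar x)-t\,df(\bar x)(\bar u)}{\frac12t^2}\in[-\infty,+\infty].$$ **Corollary (Second-order subderivatives and identifiability).** Let $f\colon\mathbb{R}^n\to\mathbb{R}\cup\{+\infty\}$ be lsc, and suppose that $0\in\partial_p f(\bar x)$ and that $\mathcal{M}$ is a $C^3$ identifiable manifold of $f$ at $\bar x$ for $0$. Let $\bar u\in T_{\mathcal{M}}(\bar x)$ be nonzero and let $\bar w\in\mathbb{R}^n$. Then for every real $\epsilon>0$ there exist $\hat u\in T_{\mathcal{M}}(\bar x)$ and $\hat w\in\mathbb{R}^n$ satisfying $|\bar u-\hat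 u|\le\epsilon$ and $$d^2f(\bar x)(\bar u|\bar w)\ \ge\ d^2(f+\delta_{\mathcal{M}})(\bar x)(\hat u|\hat w).$$ -/

import Mathlib

open Filter Topology

noncomputable section

/-- The indicator function `δ_Q`: zero on `Q` and `+∞` off `Q`. -/
def indicatorFn {n : ℕ} (Q : Set (EuclideanSpace ℝ (Fin n))) :
    EuclideanSpace ℝ (Fin n) → EReal :=
  open Classical in fun x => if x ∈ Q then 0 else ⊤

/-- The proximal subdifferential `∂_p f(x)`: `f x` is finite and
`f y ≥ f x + ⟪v, y - x⟫ + O(‖y - x‖²)` as `y → x`. -/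
def proxSubdiff {n : ℕ} (f : EuclideanSpace ℝ (Fin n) → EReal)
    (x : EuclideanSpace ℝ (Fin n)) : Set (EuclideanSpace ℝ (Fin n)) :=
  {v | f x ≠ ⊤ ∧ f x ≠ ⊥ ∧ ∃ C : ℝ, ∀ᶠ y in 𝓝 x,
    f x + ((inner ℝ v (y - x) - C * ‖y - x‖ ^ 2 : ℝ) : EReal) ≤ f y}

/-- The limiting subdifferential `∂f(x)`. -/
def limSubdiff {n : ℕ} (f : EuclideanSpace ℝ (Fin n) → EReal)
    (x : EuclideanSpace ℝ (Fin n)) : Set (EuclideanSpace ℝ (Fin n)) :=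
  {v | f x ≠ ⊤ ∧ f x ≠ ⊥ ∧ ∃ (xs vs : ℕ → EuclideanSpace ℝ (Fin n)),
    (∀ i, vs i ∈ proxSubdiff f (xs i)) ∧ Tendsto xs atTop (𝓝 x) ∧
    Tendsto (fun i => f (xs i)) atTop (𝓝 (f x)) ∧ Tendsto vs atTop (𝓝 v)}

/-- `F = 0` is a `C^p` local equation of the set `M` at `x`: `F` is `C^p`, its derivative at `x` has
full rank, and `M` coincides with the zero set of `F` on a neighborhood of `x`. -/
structure IsLocalEquation {n m : ℕ} (p : WithTop ℕ∞) (M : Set (EuclideanSpace ℝ (Fin n)))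
    (x : EuclideanSpace ℝ (Fin n))
    (F : EuclideanSpace ℝ (Fin n) → EuclideanSpace ℝ (Fin m)) : Prop where
  contDiff : ContDiff ℝ p F
  surjective : Function.Surjective (fderiv ℝ F x)
  mem_iff : ∀ᶠ y in 𝓝 x, y ∈ M ↔ F y = 0

/-- `M` is a `C^p` manifold around its point `x` (`p ≥ 1`). Since the rank condition is open, one
local equation at `x` is also a local equation at all points of `M` near `x`. -/
def IsManifoldAround {n : ℕ} (p : WithTop ℕ∞) (M : Set (EuclideanSpace ℝ (Fin n)))
    (x : EuclideanSpace ℝ (Fin n)) : Prop :=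
  x ∈ M ∧ ∃ (m : ℕ) (F : EuclideanSpace ℝ (Fin n) → EuclideanSpace ℝ (Fin m)),
    IsLocalEquation p M x F

/-- The tangent space `T_M(x) = ker ∇F(x)` of a `C^p` manifold `M` around `x`, where `F = 0` is a
`C^p` local equation of `M` at `x`; the kernel does not depend on the equation. -/
def manifoldTangentSpace {n : ℕ} (p : WithTop ℕ∞) (M : Set (EuclideanSpace ℝ (Fin n)))
    (x : EuclideanSpace ℝ (Fin n)) : Set (EuclideanSpace ℝ (Fin n)) :=
  {u | ∃ (m : ℕ) (F : EuclideanSpace ℝ (Fin n) → EuclideanSpace ℝ (Fin m)),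
    IsLocalEquation p M x F ∧ fderiv ℝ F x u = 0}

/-- The restriction of `f` to `M` is `C^p`-smooth around `x`: near `x`, it agrees on `M` with a
real-valued `C^p` function. -/
def IsSmoothOnAround {n : ℕ} (p : WithTop ℕ∞) (f : EuclideanSpace ℝ (Fin n) → EReal)
    (M : Set (EuclideanSpace ℝ (Fin n))) (x : EuclideanSpace ℝ (Fin n)) : Prop :=
  ∃ g : EuclideanSpace ℝ (Fin n) → ℝ, ContDiff ℝ p g ∧
    ∀ᶠ y in 𝓝 x, y ∈ M → f y = ((g y : ℝ) : EReal)

/-- `M` is a `C^p` identifiable manifold of `f` at `x ∈ M` for `v ∈ ∂f(x)`. -/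
structure IsIdentifiableManifold {n : ℕ} (p : WithTop ℕ∞)
    (f : EuclideanSpace ℝ (Fin n) → EReal) (M : Set (EuclideanSpace ℝ (Fin n)))
    (x v : EuclideanSpace ℝ (Fin n)) : Prop where
  mem_limSubdiff : v ∈ limSubdiff f x
  isManifoldAround : IsManifoldAround p M x
  isSmoothOnAround : IsSmoothOnAround p f M x
  identification : ∀ xs vs : ℕ → EuclideanSpace ℝ (Fin n),
    Tendsto xs atTop (𝓝 x) → Tendsto (fun i => f (xs i)) atTop (𝓝 (f x)) →
    Tendsto vs atTop (𝓝 v) → (∀ i, vs i ∈ limSubdiff f (xs i)) →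
    ∀ᶠ i in atTop, xs i ∈ M

/-- The subderivative `df(x)(u)`, for `f x` finite: the lower limit of `(f(x + t u') - f(x)) / t`
as `t ↘ 0` and `u' → u`. -/
def subderivative {n : ℕ} (f : EuclideanSpace ℝ (Fin n) → EReal)
    (x u : EuclideanSpace ℝ (Fin n)) : EReal :=
  liminf (fun q : ℝ × EuclideanSpace ℝ (Fin n) => (f (x + q.1 • q.2) - f x) / ((q.1 : ℝ) : EReal))
    (𝓝[>] (0 : ℝ) ×ˢ 𝓝 u)

/-- The parabolic subderivative `d²f(x)(u|w)`, for `f x` and `df(x)(u)` finite: the lower limit of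
`(f(x + t u + t² w' / 2) - f(x) - t df(x)(u)) / (t² / 2)` as `t ↘ 0` and `w' → w`. -/
def parabolicSubderivative {n : ℕ} (f : EuclideanSpace ℝ (Fin n) → EReal)
    (x u w : EuclideanSpace ℝ (Fin n)) : EReal :=
  liminf (fun q : ℝ × EuclideanSpace ℝ (Fin n) =>
      (f (x + q.1 • u + (q.1 ^ 2 / 2) • q.2) - f x - ((q.1 : ℝ) : EReal) * subderivative f x u) /
        ((q.1 ^ 2 / 2 : ℝ) : EReal))
    (𝓝[>] (0 : ℝ) ×ˢ 𝓝 w)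

end

open Filter Topology

/-! The choice û = ū works: the Hessian of a Lagrangian at ū separates the two parabolic
subderivatives. Since 0 is a proximal subgradient, f ≥ f(x) - C|y - x|² near x. Hence the smooth
representative of f on M is critical along the tangent space, and subtracting a multiplier term
gives φ with φ = f on M near x and ∇φ(x) = 0 (`exists_lagrangian`). Let Q = ∇²φ(x)(u,u).
Second-order quotients of f along points of M whose directions tend to u converge to Q
(`tendsto_second_order_quotient`), whatever the curvature of the path. Upper bound: M contains a
parabolic sequence tangent to u, with second-order term tending to some w', so the parabolic
subderivative of f + δ_M at (u|w') is at most Q. Lower bound: if that of f at (u|w) were below c <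
Q, there would be points z on arcs, off M in general, with f(z) ≤ f(x) + ct²/2. Minimizing f plus a
quadratic penalty centered at z moves z by at most εt without raising f, and yields a subgradient of
size O(t) (`exists_small_proximal_subgradient`). Identifiability puts the new points in M, their
directions can be made to tend to u, and the quotients there force Q ≤ c. -/

/-! ### Second-order calculus on the zero set of a submersion. -/

/-- Second-order Taylor expansion with Peano remainder. -/
theorem ContDiffAt.taylor_two_isLittleO {E G : Type*} [NormedAddCommGroup E] [NormedSpace ℝ E]
    [NormedAddCommGroup G] [NormedSpace ℝ G] {φ : E → G} {x : E} (hφ : ContDiffAt ℝ 2 φ x) :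
    (fun h => φ (x + h) - φ x - fderiv ℝ φ x h - (1 / 2 : ℝ) • fderiv ℝ (fderiv ℝ φ) x h h)
      =o[𝓝 0] fun h => ‖h‖ ^ 2 := by
  have hsymm : IsSymmSndFDerivAt ℝ φ x := hφ.isSymmSndFDerivAt (by simp)
  set B := fderiv ℝ (fderiv ℝ φ) x with hB
  have hd : ∀ᶠ k in 𝓝 (0 : E), DifferentiableAt ℝ φ (x + k) := by
    have h1 : ∀ᶠ y in 𝓝 x, ContDiffAt ℝ 2 φ y := hφ.eventually (by simp)
    have h2 : Tendsto (fun k : E => x + k) (𝓝 0) (𝓝 x) := by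
      simpa using (continuous_const_add x).tendsto 0
    exact (h2.eventually h1).mono fun k hk => hk.differentiableAt (by simp)
  have hD : HasFDerivAt (fderiv ℝ φ) B x :=
    ((hφ.fderiv_right (m := 1) (by norm_num)).differentiableAt (by simp)).hasFDerivAt
  rw [hasFDerivAt_iff_isLittleO_nhds_zero] at hD
  refine Asymptotics.isLittleO_iff.2 fun ε hε => ?_
  obtain ⟨r, hr, hball⟩ := Metric.eventually_nhds_iff_ball.1 (hd.and (hD.bound hε))
  filter_upwards [Metric.ball_mem_nhds (0 : E) hr] with h hh
  -- The derivative of the remainder ψ is the first-order remainder of the derivative of φ, so the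
  -- mean value inequality on the ball of radius ‖h‖ gives o(‖h‖²).
  set ψ : E → G := fun k => φ (x + k) - φ x - fderiv ℝ φ x k - (1 / 2 : ℝ) • B k k with hψ
  have hderiv : ∀ k ∈ Metric.closedBall (0 : E) ‖h‖, HasFDerivWithinAt ψ
      (fderiv ℝ φ (x + k) - fderiv ℝ φ x - B k) (Metric.closedBall (0 : E) ‖h‖) k := by
    intro k hk
    have hkr : k ∈ Metric.ball (0 : E) r := by
      simp only [Metric.mem_closedBall, Metric.mem_ball, dist_zero_right] at *
      linarith
    have e1 : HasFDerivAt (fun k => φ (x + k)) (fderiv ℝ φ (x + k)) k := by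
      have := (hball k hkr).1.hasFDerivAt
      exact (hasFDerivAt_comp_add_left x).2 this
    have e2 : HasFDerivAt (fun k => B k k) (B k + B.flip k) k := by
      have := B.hasFDerivAt (x := k) |>.clm_apply (hasFDerivAt_id k)
      refine this.congr_fderiv ?_
      ext v
      simp
    have e3 := ((e1.sub_const (φ x)).sub (fderiv ℝ φ x).hasFDerivAt).sub
      (e2.const_smul (1 / 2 : ℝ))
    refine (e3.congr_fderiv ?_).hasFDerivWithinAt
    ext v
    have hs : B v k = B k v := hsymm.eq v k
    simp only [_root_.sub_apply, _root_.smul_apply,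
      _root_.add_apply, ContinuousLinearMap.flip_apply, hs]
    rw [← two_smul ℝ, smul_smul]
    norm_num
  have hbound : ∀ k ∈ Metric.closedBall (0 : E) ‖h‖,
      ‖fderiv ℝ φ (x + k) - fderiv ℝ φ x - B k‖ ≤ ε * ‖h‖ := by
    intro k hk
    simp only [Metric.mem_closedBall, Metric.mem_ball, dist_zero_right] at hk hh
    refine ((hball k (by simpa using hk.trans_lt hh)).2).trans ?_
    gcongr
  have := (convex_closedBall (0 : E) ‖h‖).norm_image_sub_le_of_norm_hasFDerivWithin_le
    hderiv hbound (x := 0) (y := h) (by simp) (by simp)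
  have h0 : ψ 0 = 0 := by simp [hψ]
  rw [h0, sub_zero, sub_zero] at this
  calc ‖ψ h‖ ≤ ε * ‖h‖ * ‖h‖ := this
    _ = ε * ‖‖h‖ ^ 2‖ := by rw [norm_pow, norm_norm]; ring

/-- Metric regularity of a submersion (Lyusternik–Graves): the distance to the zero set is
controlled linearly by the residual. -/
theorem HasStrictFDerivAt.exists_zero_norm_sub_le {E G : Type*} [NormedAddCommGroup E]
    [NormedSpace ℝ E] [CompleteSpace E] [NormedAddCommGroup G] [NormedSpace ℝ G] [CompleteSpace G]
    {F : E → G} {F' : E →L[ℝ] G} {x : E} (hF : HasStrictFDerivAt F F' x)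
    (hsurj : Function.Surjective F') (hx : F x = 0) :
    ∃ K : ℝ, 0 ≤ K ∧ ∀ᶠ b in 𝓝 x, ∃ y, F y = 0 ∧ ‖y - b‖ ≤ K * ‖F b‖ := by
  have hrange : F'.range = ⊤ := LinearMap.range_eq_top.2 hsurj
  let R := F'.nonlinearRightInverseOfSurjective hrange
  have hR : 0 < R.nnnorm := F'.nonlinearRightInverseOfSurjective_nnnorm_pos hrange
  -- Half of the critical rate R⁻¹ remains, so a ball of radius 2R‖F b‖ around b is mapped onto a
  -- set containing 0.
  have hc : (0 : NNReal) < R.nnnorm⁻¹ / 2 := half_pos (inv_pos.2 hR)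
  obtain ⟨s, hs, happ⟩ := hF.approximates_deriv_on_nhds (Or.inr hc)
  obtain ⟨r, hr, hball⟩ := Metric.nhds_basis_closedBall.mem_iff.1 hs
  have hR' : (0 : ℝ) < R.nnnorm := hR
  refine ⟨2 * R.nnnorm, by positivity, ?_⟩
  have hcont : Tendsto (fun b => ‖b - x‖ + 2 * (R.nnnorm : ℝ) * ‖F b‖) (𝓝 x) (𝓝 0) := by
    have h1 : ContinuousAt (fun b => ‖b - x‖ + 2 * (R.nnnorm : ℝ) * ‖F b‖) x := by
      have := hF.continuousAt
      fun_prop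
    simpa [ContinuousAt, hx] using h1
  filter_upwards [hcont.eventually (gt_mem_nhds hr)] with b hb
  have hsub : Metric.closedBall b (2 * (R.nnnorm : ℝ) * ‖F b‖) ⊆ s := by
    refine (Metric.closedBall_subset_closedBall' ?_).trans hball
    rw [dist_eq_norm]
    linarith
  obtain ⟨y, hy, hy0⟩ := happ.surjOn_closedBall_of_nonlinearRightInverse R
    (by positivity) hsub (a := 0) (by
      rw [Metric.mem_closedBall, dist_zero_left]
      push_cast
      field_simp
      norm_num)
  exact ⟨y, hy0, by simpa [dist_eq_norm] using hy⟩

/-- A tangent direction of the zero set of a submersion is realized by a parabolic sequence. -/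
theorem exists_parabolic_seq_zero {E G : Type*} [NormedAddCommGroup E]
    [NormedSpace ℝ E] [FiniteDimensional ℝ E] [NormedAddCommGroup G] [NormedSpace ℝ G]
    [CompleteSpace G] {F : E → G} {x u : E} (hF : ContDiffAt ℝ 2 F x)
    (hsurj : Function.Surjective (fderiv ℝ F x)) (hx : F x = 0) (hu : fderiv ℝ F x u = 0) :
    ∃ (t : ℕ → ℝ) (ws : ℕ → E) (w : E), Tendsto t atTop (𝓝[>] 0) ∧ Tendsto ws atTop (𝓝 w) ∧
      ∀ k, F (x + t k • u + (t k ^ 2 / 2) • ws k) = 0 := by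
  have : CompleteSpace E := FiniteDimensional.complete ℝ E
  obtain ⟨K, hK, hev⟩ :=
    (hF.hasStrictFDerivAt (by simp)).exists_zero_norm_sub_le hsurj hx
  set B := fderiv ℝ (fderiv ℝ F) x
  have ht0 : Tendsto (fun t : ℝ => t • u) (𝓝[>] 0) (𝓝 0) := by
    have : Tendsto (fun t : ℝ => t • u) (𝓝 0) (𝓝 ((0 : ℝ) • u)) :=
      (continuous_id.smul continuous_const).tendsto 0
    rw [zero_smul] at this
    exact this.mono_left nhdsWithin_le_nhds
  have htx : Tendsto (fun t : ℝ => x + t • u) (𝓝[>] 0) (𝓝 x) := by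
    simpa using ht0.const_add x
  -- ‖u‖² bounds the Taylor remainder (taken with constant 1), the other term the Hessian part; the
  -- 2 comes from dividing by t²/2.
  set D : ℝ := 2 * K * (‖u‖ ^ 2 + 1 / 2 * (‖B‖ * ‖u‖ * ‖u‖)) with hD
  have key : ∀ᶠ t : ℝ in 𝓝[>] 0, ∃ w ∈ Metric.closedBall (0 : E) D,
      F (x + t • u + (t ^ 2 / 2) • w) = 0 := by
    filter_upwards [htx.eventually hev, ht0.eventually (hF.taylor_two_isLittleO.bound one_pos),
      self_mem_nhdsWithin] with t h1 h2 (h3 : 0 < t)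
    obtain ⟨y, hy0, hy⟩ := h1
    refine ⟨(2 / t ^ 2) • (y - (x + t • u)), ?_, ?_⟩
    · have hFb : ‖F (x + t • u)‖ ≤ t ^ 2 * (‖u‖ ^ 2 + 1 / 2 * (‖B‖ * ‖u‖ * ‖u‖)) := by
        simp only [hx, hu, map_smul, smul_zero, sub_zero, _root_.smul_apply,
          norm_pow, norm_smul, Real.norm_eq_abs, abs_of_pos h3, one_mul, sq_abs] at h2
        have h4 : ‖(1 / 2 : ℝ) • t • t • B u u‖ ≤ 1 / 2 * (t * (t * (‖B‖ * ‖u‖ * ‖u‖))) := by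
          rw [norm_smul, norm_smul, norm_smul, Real.norm_eq_abs, Real.norm_eq_abs, abs_of_pos h3,
            abs_of_pos (by norm_num : (0 : ℝ) < 1 / 2)]
          gcongr
          exact B.le_opNorm₂ u u
        have h5 := norm_le_norm_add_norm_sub' (F (x + t • u)) ((1 / 2 : ℝ) • t • t • B u u)
        nlinarith
      rw [mem_closedBall_zero_iff, norm_smul, Real.norm_eq_abs, abs_of_pos (by positivity), hD]
      calc 2 / t ^ 2 * ‖y - (x + t • u)‖
          ≤ 2 / t ^ 2 * (K * (t ^ 2 * (‖u‖ ^ 2 + 1 / 2 * (‖B‖ * ‖u‖ * ‖u‖)))) := by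
            gcongr
            exact hy.trans (by gcongr)
        _ = _ := by field_simp
    · rw [smul_smul, show t ^ 2 / 2 * (2 / t ^ 2) = 1 by field_simp, one_smul,
        add_sub_cancel, hy0]
  obtain ⟨t, ht, hex⟩ := exists_seq_forall_of_frequently key.frequently
  choose ws hws hz using hex
  obtain ⟨w, -, σ, hσ, hlim⟩ := (isCompact_closedBall (0 : E) D).tendsto_subseq hws
  exact ⟨t ∘ σ, ws ∘ σ, w, ht.comp hσ.tendsto_atTop, hlim, fun k => hz (σ k)⟩

/-- If `φ` is critical at `x`, its second-order difference quotients along `x + t k • v k` with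
`t k ↘ 0` and `v k → u` converge to the second derivative. -/
theorem tendsto_second_order_quotient {E : Type*} [NormedAddCommGroup E] [NormedSpace ℝ E]
    {φ : E → ℝ} {x u : E} (hφ : ContDiffAt ℝ 2 φ x) (hcrit : fderiv ℝ φ x = 0)
    {t : ℕ → ℝ} {v : ℕ → E} (ht : Tendsto t atTop (𝓝[>] 0)) (hv : Tendsto v atTop (𝓝 u)) :
    Tendsto (fun k => (φ (x + t k • v k) - φ x) / (t k ^ 2 / 2)) atTop
      (𝓝 (fderiv ℝ (fderiv ℝ φ) x u u)) := by
  set B := fderiv ℝ (fderiv ℝ φ) x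
  have ht' := tendsto_nhdsWithin_iff.1 ht
  have htv : Tendsto (fun k => t k • v k) atTop (𝓝 0) := by simpa using ht'.1.smul hv
  have h1 := hφ.taylor_two_isLittleO.comp_tendsto htv
  have h2 : (fun k => ‖t k • v k‖ ^ 2) =O[atTop] fun k => t k ^ 2 := by
    have hb : (fun k => t k • v k) =O[atTop] fun k => t k * 1 := by
      simpa using (Asymptotics.isBigO_refl t atTop).smul (hv.isBigO_one ℝ)
    simpa using hb.norm_left.pow 2
  have h3 := (h1.trans_isBigO h2).tendsto_div_nhds_zero
  have h4 : Tendsto (fun k => B (v k) (v k)) atTop (𝓝 (B u u)) :=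
    (B.continuous₂.tendsto (u, u)).comp (hv.prodMk_nhds hv)
  have h5 := (h3.const_mul 2).add h4
  rw [mul_zero, zero_add] at h5
  refine h5.congr' ?_
  filter_upwards [ht'.2] with k (hk : 0 < t k)
  simp only [Function.comp, hcrit, map_smul, _root_.smul_apply,
    _root_.zero_apply, smul_eq_mul]
  field_simp
  ring

/-- Lagrange multipliers: a linear form vanishing on the kernel of a surjective operator factors
through it. -/
theorem ContinuousLinearMap.exists_comp_eq_of_surjective {E G : Type*} [NormedAddCommGroup E]
    [NormedSpace ℝ E] [NormedAddCommGroup G] [NormedSpace ℝ G] [FiniteDimensional ℝ G]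
    (A : E →L[ℝ] G) (hA : Function.Surjective A) (l : E →L[ℝ] ℝ)
    (hl : ∀ v, A v = 0 → l v = 0) : ∃ μ : G →L[ℝ] ℝ, μ.comp A = l := by
  obtain ⟨R, hR⟩ := (A : E →ₗ[ℝ] G).exists_rightInverse_of_surjective
    (LinearMap.range_eq_top.2 hA)
  refine ⟨LinearMap.toContinuousLinearMap ((l : E →ₗ[ℝ] ℝ).comp R), ?_⟩
  ext v
  have hAR : A (R (A v)) = A v := LinearMap.congr_fun hR (A v)
  have := hl (R (A v) - v) (by rw [map_sub, hAR, sub_self])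
  rw [map_sub, sub_eq_zero] at this
  simpa using this

/-- A function with a minimum, relative to the zero set of a submersion, up to a quadratic error
has derivative zero along the tangent space. -/
theorem fderiv_eq_zero_of_quadratic_min {E G : Type*} [NormedAddCommGroup E]
    [NormedSpace ℝ E] [FiniteDimensional ℝ E] [NormedAddCommGroup G] [NormedSpace ℝ G]
    [CompleteSpace G] {F : E → G} {g : E → ℝ} {x v : E} {C : ℝ} (hF : ContDiffAt ℝ 2 F x)
    (hsurj : Function.Surjective (fderiv ℝ F x)) (hx : F x = 0) (hg : DifferentiableAt ℝ g x)
    (hmin : ∀ᶠ y in 𝓝 x, F y = 0 → g x - C * ‖y - x‖ ^ 2 ≤ g y) (hv : fderiv ℝ F x v = 0) :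
    fderiv ℝ g x v = 0 := by
  -- The minimum gives only an inequality; applying it to v and -v gives equality.
  have key : ∀ v, fderiv ℝ F x v = 0 → 0 ≤ fderiv ℝ g x v := by
    intro v hv
    obtain ⟨t, ws, w, ht, hws, hz⟩ := exists_parabolic_seq_zero hF hsurj hx hv
    have ht' := tendsto_nhdsWithin_iff.1 ht
    set d : ℕ → E := fun k => v + (t k / 2) • ws k with hd
    have hdv : Tendsto d atTop (𝓝 v) := by
      simpa using ((ht'.1.div_const 2).smul hws).const_add v
    have heq : ∀ k, x + t k • v + (t k ^ 2 / 2) • ws k = x + t k • d k := by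
      intro k
      simp only [hd, smul_add, smul_smul, add_assoc]
      congr 4
      ring
    have htd : Tendsto (fun k => t k • d k) atTop (𝓝 0) := by simpa using ht'.1.smul hdv
    have hlim : Tendsto (fun k => (t k)⁻¹ • (g (x + t k • d k) - g x)) atTop
        (𝓝 (fderiv ℝ g x v)) := by
      have h1 := hg.hasFDerivAt
      rw [hasFDerivAt_iff_isLittleO_nhds_zero] at h1
      have h2 := h1.comp_tendsto htd
      have h3 : (fun k => t k • d k) =O[atTop] t := by
        simpa using (Asymptotics.isBigO_refl t atTop).smul (hdv.isBigO_one ℝ)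
      have h4 := (h2.trans_isBigO h3).tendsto_div_nhds_zero
      have h5 := h4.add (((fderiv ℝ g x).continuous.tendsto v).comp hdv)
      rw [zero_add] at h5
      refine h5.congr' ?_
      filter_upwards [ht'.2] with k (hk : 0 < t k)
      simp only [Function.comp, map_smul, smul_eq_mul]
      field_simp
      ring
    have hlow : Tendsto (fun k => -C * (t k * ‖d k‖ ^ 2)) atTop (𝓝 0) := by
      simpa using (ht'.1.mul (hdv.norm.pow 2)).const_mul (-C)
    refine le_of_tendsto_of_tendsto hlow hlim ?_
    have hxd : Tendsto (fun k => x + t k • d k) atTop (𝓝 x) := by simpa using htd.const_add x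
    filter_upwards [ht'.2, hxd.eventually hmin] with k (hk : 0 < t k) hk2
    have h6 := hk2 (by rw [← heq, hz])
    rw [add_sub_cancel_left, norm_smul, Real.norm_eq_abs, abs_of_pos hk] at h6
    rw [smul_eq_mul, inv_mul_eq_div, le_div_iff₀ hk]
    linarith
  refine le_antisymm ?_ (key v hv)
  have := key (-v) (by rw [map_neg, hv, neg_zero])
  rw [map_neg] at this
  linarith

/-- The Lagrangian: a function which agrees with `g` on the zero set of `F` and is critical at
`x`. -/
theorem exists_lagrangian {E G : Type*} [NormedAddCommGroup E]
    [NormedSpace ℝ E] [NormedAddCommGroup G] [NormedSpace ℝ G]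
    [FiniteDimensional ℝ G] {F : E → G} {g : E → ℝ} {x : E} (hF : ContDiff ℝ 2 F)
    (hsurj : Function.Surjective (fderiv ℝ F x)) (hg : ContDiff ℝ 2 g)
    (hker : ∀ v, fderiv ℝ F x v = 0 → fderiv ℝ g x v = 0) :
    ∃ φ : E → ℝ, ContDiff ℝ 2 φ ∧ fderiv ℝ φ x = 0 ∧ ∀ y, F y = 0 → φ y = g y := by
  obtain ⟨μ, hμ⟩ := (fderiv ℝ F x).exists_comp_eq_of_surjective hsurj _ hker
  refine ⟨fun y => g y - μ (F y), hg.sub (μ.contDiff.comp hF), ?_, fun y hy => by simp [hy]⟩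
  have h1 := (hg.differentiable (by simp) x).hasFDerivAt
  have h2 := (hF.differentiable (by simp) x).hasFDerivAt
  have h3 : HasFDerivAt (fun y => g y - μ (F y)) (fderiv ℝ g x - μ.comp (fderiv ℝ F x)) x :=
    h1.sub (μ.hasFDerivAt.comp x h2)
  rw [h3.fderiv, hμ, sub_self]

/-! ### Subderivatives tested along sequences. -/

section

variable {n : ℕ}

/-- The quadratic minorant bounds the quotients below by -Ct|u'|², which tends to 0; a single
sequence with o(t) growth suffices for the upper bound. -/
theorem subderivative_eq_zero {h : EuclideanSpace ℝ (Fin n) → EReal}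
    {x u : EuclideanSpace ℝ (Fin n)} {a C : ℝ} (hx : h x = (a : EReal))
    (hlow : ∀ᶠ y in 𝓝 x, ((a - C * ‖y - x‖ ^ 2 : ℝ) : EReal) ≤ h y)
    {t r : ℕ → ℝ} {v : ℕ → EuclideanSpace ℝ (Fin n)} (ht : Tendsto t atTop (𝓝[>] 0))
    (hv : Tendsto v atTop (𝓝 u)) (hr : Tendsto r atTop (𝓝 0))
    (hle : ∀ᶠ k in atTop, h (x + t k • v k) ≤ ((a + t k * r k : ℝ) : EReal)) :
    subderivative h x u = 0 := by
  have ht' := tendsto_nhdsWithin_iff.1 ht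
  apply le_antisymm
  · have hr' : Tendsto (fun k => ((r k : ℝ) : EReal)) atTop (𝓝 ((0 : ℝ) : EReal)) :=
      EReal.tendsto_coe.2 hr
    calc subderivative h x u
        ≤ liminf (fun k => (h (x + t k • v k) - h x) / ((t k : ℝ) : EReal)) atTop :=
          (ht.prodMk hv).liminf_le_liminf_comp
      _ ≤ liminf (fun k => ((r k : ℝ) : EReal)) atTop := by
          refine liminf_le_liminf ?_
          filter_upwards [ht'.2, hle] with k (hk : 0 < t k) hk2
          rw [EReal.div_le_iff_le_mul (by exact_mod_cast hk) (EReal.coe_ne_top _), hx]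
          refine EReal.sub_le_of_le_add' ?_
          exact_mod_cast hk2
      _ = 0 := hr'.liminf_eq
  · have hq1 : Tendsto (fun q : ℝ × EuclideanSpace ℝ (Fin n) => q.1)
        (𝓝[>] (0 : ℝ) ×ˢ 𝓝 u) (𝓝 0) := tendsto_fst.mono_right nhdsWithin_le_nhds
    have hq2 : Tendsto (fun q : ℝ × EuclideanSpace ℝ (Fin n) => q.2)
        (𝓝[>] (0 : ℝ) ×ˢ 𝓝 u) (𝓝 u) := tendsto_snd
    have hb : Tendsto (fun q : ℝ × EuclideanSpace ℝ (Fin n) => -C * (q.1 * ‖q.2‖ ^ 2))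
        (𝓝[>] (0 : ℝ) ×ˢ 𝓝 u) (𝓝 0) := by
      simpa using (hq1.mul (hq2.norm.pow 2)).const_mul (-C)
    have hb' := EReal.tendsto_coe.2 hb
    have hxq : Tendsto (fun q : ℝ × EuclideanSpace ℝ (Fin n) => x + q.1 • q.2)
        (𝓝[>] (0 : ℝ) ×ˢ 𝓝 u) (𝓝 x) := by
      simpa using (hq1.smul hq2).const_add x
    calc (0 : EReal) = _ := hb'.liminf_eq.symm
      _ ≤ subderivative h x u := by
          refine liminf_le_liminf ?_
          filter_upwards [tendsto_fst.eventually self_mem_nhdsWithin, hxq.eventually hlow]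
            with q (hq : 0 < q.1) hq2
          rw [add_sub_cancel_left, norm_smul, Real.norm_eq_abs, abs_of_pos hq] at hq2
          rw [EReal.le_div_iff_mul_le (by exact_mod_cast hq) (EReal.coe_ne_top _), hx]
          refine le_trans ?_ (EReal.sub_le_sub hq2 le_rfl)
          norm_cast
          apply le_of_eq
          ring

theorem parabolicSubderivative_le {h : EuclideanSpace ℝ (Fin n) → EReal}
    {x u w : EuclideanSpace ℝ (Fin n)} {a b : ℝ} (hx : h x = (a : EReal))
    (hsub : subderivative h x u = 0)
    {t q : ℕ → ℝ} {ws : ℕ → EuclideanSpace ℝ (Fin n)} (ht : Tendsto t atTop (𝓝[>] 0))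
    (hws : Tendsto ws atTop (𝓝 w)) (hq : Tendsto q atTop (𝓝 b))
    (hle : ∀ᶠ k in atTop, h (x + t k • u + (t k ^ 2 / 2) • ws k) ≤
      ((a + t k ^ 2 / 2 * q k : ℝ) : EReal)) :
    parabolicSubderivative h x u w ≤ (b : EReal) := by
  have ht' := tendsto_nhdsWithin_iff.1 ht
  have hq' := EReal.tendsto_coe.2 hq
  calc parabolicSubderivative h x u w
      ≤ liminf (fun k => (h (x + t k • u + (t k ^ 2 / 2) • ws k) - h x -
          ((t k : ℝ) : EReal) * subderivative h x u) / ((t k ^ 2 / 2 : ℝ) : EReal)) atTop :=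
        (ht.prodMk hws).liminf_le_liminf_comp
    _ ≤ liminf (fun k => ((q k : ℝ) : EReal)) atTop := by
        refine liminf_le_liminf ?_
        filter_upwards [ht'.2, hle] with k (hk : 0 < t k) hk2
        have hk3 : 0 < t k ^ 2 / 2 := by positivity
        rw [EReal.div_le_iff_le_mul (by exact_mod_cast hk3) (EReal.coe_ne_top _), hx, hsub,
          mul_zero, sub_zero]
        refine EReal.sub_le_of_le_add' ?_
        exact_mod_cast hk2
    _ = b := hq'.liminf_eq

/-- As the first-order term vanishes, the quotient inequality can be cleared into a bound on values
of h, the form that penalization takes as input. -/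
theorem frequently_le_of_parabolicSubderivative_lt {h : EuclideanSpace ℝ (Fin n) → EReal}
    {x u w : EuclideanSpace ℝ (Fin n)} {a c : ℝ} (hx : h x = (a : EReal))
    (hsub : subderivative h x u = 0) (hlt : parabolicSubderivative h x u w < (c : EReal)) :
    ∃ᶠ q : ℝ × EuclideanSpace ℝ (Fin n) in 𝓝[>] (0 : ℝ) ×ˢ 𝓝 w,
      h (x + q.1 • u + (q.1 ^ 2 / 2) • q.2) ≤ ((a + c * (q.1 ^ 2 / 2) : ℝ) : EReal) := by
  have h1 := frequently_lt_of_liminf_lt (by isBoundedDefault) hlt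
  have h2 : ∀ᶠ q : ℝ × EuclideanSpace ℝ (Fin n) in 𝓝[>] (0 : ℝ) ×ˢ 𝓝 w, 0 < q.1 :=
    tendsto_fst.eventually self_mem_nhdsWithin
  refine (h1.and_eventually h2).mono fun q ⟨hq, hpos⟩ => ?_
  have hpos' : 0 < q.1 ^ 2 / 2 := by positivity
  have h3 := (EReal.div_le_iff_le_mul (by exact_mod_cast hpos') (EReal.coe_ne_top _)).1 hq.le
  rw [hx, hsub, mul_zero, sub_zero,
    EReal.sub_le_iff_le_add (.inl (EReal.coe_ne_bot _)) (.inl (EReal.coe_ne_top _))] at h3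
  refine h3.trans (le_of_eq ?_)
  norm_cast
  ring

/-! ### Penalization and identification. -/

theorem proxSubdiff_subset_limSubdiff (f : EuclideanSpace ℝ (Fin n) → EReal)
    (x : EuclideanSpace ℝ (Fin n)) : proxSubdiff f x ⊆ limSubdiff f x := fun v hv =>
  ⟨hv.1, hv.2.1, fun _ => x, fun _ => v, fun _ => hv, tendsto_const_nhds, tendsto_const_nhds,
    tendsto_const_nhds⟩

/-- A local minimizer of `f + A‖· - z‖²` has the proximal subgradient `-2A(y - z)`. -/
theorem mem_proxSubdiff_of_isLocalMin {f : EuclideanSpace ℝ (Fin n) → EReal}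
    {y z : EuclideanSpace ℝ (Fin n)} {A b : ℝ} (hb : f y = (b : EReal))
    (hmin : IsLocalMin (fun p => f p + ((A * ‖p - z‖ ^ 2 : ℝ) : EReal)) y) :
    (-(2 * A)) • (y - z) ∈ proxSubdiff f y := by
  refine ⟨by simp [hb], by simp [hb], A, hmin.mono fun p hp => ?_⟩
  have hsq : ‖p - z‖ ^ 2 = ‖y - z‖ ^ 2 + 2 * inner ℝ (y - z) (p - y) + ‖p - y‖ ^ 2 := by
    rw [← norm_add_sq_real]
    congr 2
    abel
  beta_reduce at hp
  rw [hb] at hp ⊢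
  rcases eq_or_ne (f p) ⊤ with htop | htop
  · simp [htop]
  rcases eq_or_ne (f p) ⊥ with hbt | hbt
  · simp only [hbt, EReal.bot_add, le_bot_iff] at hp
    exact absurd hp (by rw [← EReal.coe_add]; exact EReal.coe_ne_bot _)
  lift f p to ℝ using ⟨htop, hbt⟩ with e
  rw [inner_smul_left]
  norm_cast at hp ⊢
  simp only [conj_trivial]
  rw [hsq] at hp
  linarith

/-- Quadratic penalization: if `f` is minorized at `x` to second order, then near a point `z` with
`f z ≤ f x + O(t²)` and `z - x = O(t)` there is, within `ε t`, a point with no larger value and a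
proximal subgradient of size `O(t)`. -/
theorem exists_small_proximal_subgradient {f : EuclideanSpace ℝ (Fin n) → EReal}
    (hbot : ∀ x, f x ≠ ⊥) (hlsc : LowerSemicontinuous f) {x : EuclideanSpace ℝ (Fin n)}
    {a C : ℝ} (hC : 0 ≤ C)
    (hlow : ∀ᶠ y in 𝓝 x, ((a - C * ‖y - x‖ ^ 2 : ℝ) : EReal) ≤ f y)
    (K : ℝ) {B ε : ℝ} (hB : 0 ≤ B) (hε : 0 < ε) :
    ∃ A δ : ℝ, 0 < δ ∧ ∀ t : ℝ, 0 < t → t < δ → ∀ z, ‖z - x‖ ≤ B * t →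
      f z ≤ ((a + K * t ^ 2 : ℝ) : EReal) →
      ∃ y, ∃ v ∈ proxSubdiff f y, ‖y - z‖ ≤ ε * t ∧ f y ≤ f z ∧ ‖v‖ ≤ A * t := by
  obtain ⟨r, hr, hball⟩ := Metric.nhds_basis_closedBall.eventually_iff.1 hlow
  -- With s = ‖y - z‖, the estimates below give (A - 2C)s² ≤ (K + 2CB²)t² ≤ Dt². As A - 2C = D/ε²,
  -- this means s ≤ εt; the +1 keeps D positive.
  set D : ℝ := |K| + 2 * C * B ^ 2 + 1 with hD
  have hDpos : 0 < D := by positivity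
  set A : ℝ := 2 * C + D / ε ^ 2 with hA
  have hApos : 0 < A := by positivity
  refine ⟨2 * A * ε, r / (B + ε + 1), by positivity, fun t ht htδ z hz hfz => ?_⟩
  have htr : (B + ε) * t < r := by
    rw [lt_div_iff₀ (by positivity)] at htδ
    nlinarith
  have hzball : z ∈ Metric.closedBall x r := by
    rw [Metric.mem_closedBall, dist_eq_norm]
    nlinarith
  have hlsc' : LowerSemicontinuous fun p => f p + ((A * ‖p - z‖ ^ 2 : ℝ) : EReal) := by
    refine hlsc.add' (Continuous.lowerSemicontinuous ?_) fun p =>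
      EReal.continuousAt_add (.inr (EReal.coe_ne_bot _)) (.inr (EReal.coe_ne_top _))
    exact continuous_coe_real_ereal.comp (by fun_prop)
  obtain ⟨y, hy, hymin⟩ := (hlsc'.lowerSemicontinuousOn _).exists_isMinOn ⟨z, hzball⟩
    (isCompact_closedBall x r)
  have hyz : f y + ((A * ‖y - z‖ ^ 2 : ℝ) : EReal) ≤ f z := by simpa using hymin hzball
  have hyle : f y ≤ f z := by
    refine le_trans ?_ hyz
    exact le_add_of_nonneg_right (by exact_mod_cast (by positivity : 0 ≤ A * ‖y - z‖ ^ 2))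
  have hytop : f y ≠ ⊤ := ne_top_of_le_ne_top (EReal.coe_ne_top _) (hyle.trans hfz)
  obtain ⟨b, hb⟩ : ∃ b : ℝ, f y = (b : EReal) :=
    ⟨(f y).toReal, (EReal.coe_toReal hytop (hbot y)).symm⟩
  have h1 : b + A * ‖y - z‖ ^ 2 ≤ a + K * t ^ 2 := by
    have := hyz.trans hfz
    rw [hb] at this
    exact_mod_cast this
  have h2 : a - C * ‖y - x‖ ^ 2 ≤ b := by
    have := hball hy
    rw [hb] at this
    exact_mod_cast this
  have h3 : ‖y - x‖ ^ 2 ≤ 2 * ‖y - z‖ ^ 2 + 2 * (B * t) ^ 2 := by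
    have h4 : ‖y - x‖ ≤ ‖y - z‖ + B * t := by
      linarith [norm_sub_le_norm_sub_add_norm_sub y z x]
    have := pow_le_pow_left₀ (norm_nonneg _) h4 2
    nlinarith [sq_nonneg (‖y - z‖ - B * t)]
  have h5 : D / ε ^ 2 * ‖y - z‖ ^ 2 ≤ D * t ^ 2 := by
    have h6 := mul_le_mul_of_nonneg_left h3 hC
    have h7 : K * t ^ 2 ≤ |K| * t ^ 2 := by gcongr; exact le_abs_self K
    nlinarith [sq_nonneg t]
  have h8 : ‖y - z‖ ≤ ε * t := by
    refine le_of_sq_le_sq ?_ (by positivity)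
    rw [div_mul_eq_mul_div, div_le_iff₀ (by positivity), mul_assoc] at h5
    have := le_of_mul_le_mul_left h5 hDpos
    linarith [mul_pow ε t 2]
  -- The minimizer is interior to the ball, hence an unconstrained local minimizer.
  have hyx : ‖y - x‖ < r := by
    linarith [norm_sub_le_norm_sub_add_norm_sub y z x]
  have hloc : IsLocalMin (fun p => f p + ((A * ‖p - z‖ ^ 2 : ℝ) : EReal)) y :=
    hymin.isLocalMin (Metric.isOpen_ball.mem_nhds (x := y)
      (by rwa [Metric.mem_ball, dist_eq_norm]) |> mem_of_superset <| Metric.ball_subset_closedBall)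
  refine ⟨y, _, mem_proxSubdiff_of_isLocalMin hb hloc, h8, hyle, ?_⟩
  rw [norm_smul, Real.norm_eq_abs, abs_neg, abs_of_pos (by positivity),
    mul_assoc (2 * A)]
  gcongr

/-- Along an identifiable manifold, a second-order upper bound for `f` on parabolic arcs near `u` is
inherited by points of the manifold in directions near `u`. -/
theorem frequently_le_on_identifiableManifold {f : EuclideanSpace ℝ (Fin n) → EReal}
    (hbot : ∀ x, f x ≠ ⊥) (hlsc : LowerSemicontinuous f)
    {M : Set (EuclideanSpace ℝ (Fin n))} {x u w : EuclideanSpace ℝ (Fin n)}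
    (hid : ∀ xs vs : ℕ → EuclideanSpace ℝ (Fin n),
      Tendsto xs atTop (𝓝 x) → Tendsto (fun i => f (xs i)) atTop (𝓝 (f x)) →
      Tendsto vs atTop (𝓝 0) → (∀ i, vs i ∈ limSubdiff f (xs i)) → ∀ᶠ i in atTop, xs i ∈ M)
    {a C c : ℝ} (hx : f x = (a : EReal)) (hC : 0 ≤ C)
    (hlow : ∀ᶠ y in 𝓝 x, ((a - C * ‖y - x‖ ^ 2 : ℝ) : EReal) ≤ f y)
    (hfreq : ∃ᶠ q : ℝ × EuclideanSpace ℝ (Fin n) in 𝓝[>] (0 : ℝ) ×ˢ 𝓝 w,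
      f (x + q.1 • u + (q.1 ^ 2 / 2) • q.2) ≤ ((a + c * (q.1 ^ 2 / 2) : ℝ) : EReal)) :
    ∃ᶠ p : ℝ × EuclideanSpace ℝ (Fin n) in 𝓝[>] (0 : ℝ) ×ˢ 𝓝 u,
      x + p.1 • p.2 ∈ M ∧ f (x + p.1 • p.2) ≤ ((a + c * (p.1 ^ 2 / 2) : ℝ) : EReal) := by
  rw [frequently_iff]
  intro U hU
  obtain ⟨S, hS, T, hT, hST⟩ := mem_prod_iff.1 hU
  obtain ⟨ε, hε, hεT⟩ := Metric.mem_nhds_iff.1 hT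
  -- Half of ε is for the move from z to y, half for the drift (t/2)w of the arc. With ε fixed, A is
  -- constant, so the subgradients tend to 0.
  obtain ⟨A, δ, hδ, hA⟩ := exists_small_proximal_subgradient hbot hlsc hC hlow (c / 2)
    (B := ‖u‖ + 1) (by positivity) (half_pos hε)
  have hq1 : Tendsto (fun q : ℝ × EuclideanSpace ℝ (Fin n) => q.1)
      (𝓝[>] (0 : ℝ) ×ˢ 𝓝 w) (𝓝 0) := tendsto_fst.mono_right nhdsWithin_le_nhds
  have hpos : ∀ᶠ q : ℝ × EuclideanSpace ℝ (Fin n) in 𝓝[>] (0 : ℝ) ×ˢ 𝓝 w, 0 < q.1 :=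
    tendsto_fst.eventually self_mem_nhdsWithin
  have hw : Tendsto (fun q : ℝ × EuclideanSpace ℝ (Fin n) => (q.1 / 2) • q.2)
      (𝓝[>] (0 : ℝ) ×ˢ 𝓝 w) (𝓝 0) := by
    simpa using (hq1.div_const 2).smul tendsto_snd
  have hw' : ∀ᶠ q : ℝ × EuclideanSpace ℝ (Fin n) in 𝓝[>] (0 : ℝ) ×ˢ 𝓝 w,
      ‖(q.1 / 2) • q.2‖ < min 1 (ε / 2) := by
    have := hw.norm
    rw [norm_zero] at this
    exact this.eventually (gt_mem_nhds (lt_min one_pos (half_pos hε)))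
  obtain ⟨q, hq, hprop⟩ := exists_seq_forall_of_frequently (hfreq.and_eventually
    (hpos.and ((hq1.eventually (gt_mem_nhds hδ)).and
      ((tendsto_fst.eventually hS).and hw'))))
  have harc : ∀ i, x + (q i).1 • u + ((q i).1 ^ 2 / 2) • (q i).2 =
      x + (q i).1 • (u + ((q i).1 / 2) • (q i).2) := by
    intro i
    rw [smul_add, smul_smul, add_assoc]
    congr 3
    ring
  simp only [harc] at hprop
  set t : ℕ → ℝ := fun i => (q i).1 with ht
  have htlim : Tendsto t atTop (𝓝 0) := hq1.comp hq
  set z : ℕ → EuclideanSpace ℝ (Fin n) := fun i => x + t i • (u + (t i / 2) • (q i).2) with hz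
  have hzx : ∀ i, ‖z i - x‖ ≤ (‖u‖ + 1) * t i := by
    intro i
    obtain ⟨-, h2, -, -, h5⟩ := hprop i
    have h2' : 0 < t i := h2
    rw [show z i - x = t i • (u + (t i / 2) • (q i).2) from add_sub_cancel_left _ _, norm_smul,
      Real.norm_eq_abs, abs_of_pos h2', mul_comm]
    refine mul_le_mul_of_nonneg_right ?_ h2.le
    refine (norm_add_le _ _).trans ?_
    gcongr
    exact (h5.trans_le (min_le_left _ _)).le
  have hfz : ∀ i, f (z i) ≤ ((a + c / 2 * t i ^ 2 : ℝ) : EReal) := by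
    intro i
    refine (hprop i).1.trans (le_of_eq ?_)
    congr 1
    ring
  choose y v hv hyz hfy hvA using fun i =>
    hA (t i) (hprop i).2.1 (hprop i).2.2.1 (z i) (hzx i) (hfz i)
  have hyx : Tendsto y atTop (𝓝 x) := by
    rw [tendsto_iff_norm_sub_tendsto_zero]
    refine squeeze_zero (fun _ => norm_nonneg _) (g := fun i => (ε / 2 + (‖u‖ + 1)) * t i)
      (fun i => ?_) (by simpa using htlim.const_mul (ε / 2 + (‖u‖ + 1)))
    linarith [norm_sub_le_norm_sub_add_norm_sub (y i) (z i) x, hyz i, hzx i]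
  have hv0 : Tendsto v atTop (𝓝 0) := by
    rw [tendsto_zero_iff_norm_tendsto_zero]
    exact squeeze_zero (fun _ => norm_nonneg _) hvA (by simpa using htlim.const_mul A)
  have hfyx : Tendsto (fun i => f (y i)) atTop (𝓝 (f x)) := by
    rw [hx]
    have hlo : Tendsto (fun i => a - C * ‖y i - x‖ ^ 2) atTop (𝓝 a) := by
      have := ((tendsto_iff_norm_sub_tendsto_zero.1 hyx).pow 2).const_mul C
      simpa using this.const_sub a
    have hup : Tendsto (fun i => a + c / 2 * t i ^ 2) atTop (𝓝 a) := by
      simpa using ((htlim.pow 2).const_mul (c / 2)).const_add a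
    exact tendsto_of_tendsto_of_tendsto_of_le_of_le' (EReal.tendsto_coe.2 hlo)
      (EReal.tendsto_coe.2 hup) (hyx.eventually hlow)
      (Eventually.of_forall fun i => (hfy i).trans (hfz i))
  obtain ⟨i, hi⟩ := (hid y v hyx hfyx hv0
    fun i => proxSubdiff_subset_limSubdiff f _ (hv i)).exists
  obtain ⟨h1, h2, -, h4, h5⟩ := hprop i
  have hyi : x + t i • ((t i)⁻¹ • (y i - x)) = y i := by
    rw [smul_smul, mul_inv_cancel₀ h2.ne', one_smul, add_sub_cancel]
  refine ⟨(t i, (t i)⁻¹ • (y i - x)), hST ⟨h4, hεT ?_⟩, ?_, ?_⟩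
  · have h6 : (t i)⁻¹ • (y i - x) - u = (t i)⁻¹ • (y i - z i) + (t i / 2) • (q i).2 := by
      have h7 : y i - x = (y i - z i) + t i • (u + (t i / 2) • (q i).2) := by
        rw [show t i • (u + (t i / 2) • (q i).2) = z i - x from (add_sub_cancel_left _ _).symm]
        abel
      rw [h7, smul_add, smul_smul, inv_mul_cancel₀ h2.ne', one_smul]
      abel
    have h8 : ‖(t i)⁻¹ • (y i - z i)‖ ≤ ε / 2 := by
      rw [norm_smul, norm_inv, Real.norm_eq_abs, abs_of_pos h2, inv_mul_le_iff₀ h2, mul_comm]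
      exact hyz i
    rw [Metric.mem_ball, dist_eq_norm, h6]
    have h9 := norm_add_le ((t i)⁻¹ • (y i - z i)) ((t i / 2) • (q i).2)
    linarith [h5.trans_le (min_le_right _ _)]
  · simpa only [hyi] using hi
  · simp only [hyi]
    exact (hfy i).trans h1

end

theorem corollary4p11 {n : ℕ} (f : EuclideanSpace ℝ (Fin n) → EReal)
    (hbot : ∀ x, f x ≠ ⊥) (hlsc : LowerSemicontinuous f)
    (M : Set (EuclideanSpace ℝ (Fin n))) (x : EuclideanSpace ℝ (Fin n))
    (hprox : (0 : EuclideanSpace ℝ (Fin n)) ∈ proxSubdiff f x)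
    (hM : IsIdentifiableManifold 3 f M x 0)
    (u : EuclideanSpace ℝ (Fin n)) (hu : u ∈ manifoldTangentSpace 3 M x) (hu0 : u ≠ 0)
    (w : EuclideanSpace ℝ (Fin n)) (ε : ℝ) (hε : 0 < ε) :
    ∃ u' ∈ manifoldTangentSpace 3 M x, ∃ w' : EuclideanSpace ℝ (Fin n),
      ‖u - u'‖ ≤ ε ∧
      parabolicSubderivative (fun y => f y + indicatorFn M y) x u' w' ≤
        parabolicSubderivative f x u w := by
  obtain ⟨m, F, hF, hFu⟩ := hu
  obtain ⟨g, hg, hfg⟩ := hM.isSmoothOnAround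
  have hxM : x ∈ M := hM.isManifoldAround.1
  have hFx : F x = 0 := hF.mem_iff.self_of_nhds.1 hxM
  have hfx : f x = (g x : EReal) := hfg.self_of_nhds hxM
  have hF2 : ContDiff ℝ 2 F := hF.contDiff.of_le (by norm_num)
  have hg2 : ContDiff ℝ 2 g := hg.of_le (by norm_num)
  obtain ⟨C, hC, hlow⟩ : ∃ C : ℝ, 0 ≤ C ∧
      ∀ᶠ y in 𝓝 x, ((g x - C * ‖y - x‖ ^ 2 : ℝ) : EReal) ≤ f y := by
    obtain ⟨-, -, C, hC⟩ := hprox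
    refine ⟨|C|, abs_nonneg C, hC.mono fun y hy => le_trans ?_ hy⟩
    rw [hfx, inner_zero_left]
    norm_cast
    nlinarith [le_abs_self C, sq_nonneg ‖y - x‖]
  have hker : ∀ v, fderiv ℝ F x v = 0 → fderiv ℝ g x v = 0 := fun v hv =>
    fderiv_eq_zero_of_quadratic_min (C := C) hF2.contDiffAt hF.surjective hFx
      (hg2.differentiable (by simp) x) (by
        filter_upwards [hlow, hF.mem_iff, hfg] with y h1 h2 h3 h4
        rw [h3 (h2.2 h4)] at h1
        exact_mod_cast h1) hv
  obtain ⟨φ, hφ, hcrit, hφg⟩ := exists_lagrangian hF2 hF.surjective hg2 hker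
  have hφx : φ x = g x := hφg x hFx
  obtain ⟨t, ws, w', ht, hws, hz⟩ :=
    exists_parabolic_seq_zero hF2.contDiffAt hF.surjective hFx hFu
  have ht' := tendsto_nhdsWithin_iff.1 ht
  set v : ℕ → EuclideanSpace ℝ (Fin n) := fun k => u + (t k / 2) • ws k with hv
  have hvu : Tendsto v atTop (𝓝 u) := by
    simpa using ((ht'.1.div_const 2).smul hws).const_add u
  have harc : ∀ k, x + t k • u + (t k ^ 2 / 2) • ws k = x + t k • v k := by
    intro k
    simp only [hv, smul_add, smul_smul, add_assoc]
    congr 4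
    ring
  have hq := tendsto_second_order_quotient hφ.contDiffAt hcrit ht hvu
  set q : ℕ → ℝ := fun k => (φ (x + t k • v k) - φ x) / (t k ^ 2 / 2) with hqdef
  have harcx : Tendsto (fun k => x + t k • v k) atTop (𝓝 x) := by
    simpa using (ht'.1.smul hvu).const_add x
  have hMarc : ∀ᶠ k in atTop, x + t k • v k ∈ M ∧
      f (x + t k • v k) = ((g x + t k ^ 2 / 2 * q k : ℝ) : EReal) := by
    filter_upwards [ht'.2, harcx.eventually hF.mem_iff, harcx.eventually hfg]
      with k (hk : 0 < t k) h1 h2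
    have h3 : F (x + t k • v k) = 0 := by rw [← harc, hz]
    refine ⟨h1.2 h3, ?_⟩
    rw [h2 (h1.2 h3), ← hφg _ h3, hqdef, ← hφx]
    congr 1
    field_simp
    ring
  -- The second-order growth t²q/2, written as t·(tq/2), is o(t), so the first-order subderivative
  -- vanishes.
  have hr : Tendsto (fun k => t k / 2 * q k) atTop (𝓝 0) := by
    simpa using (ht'.1.div_const 2).mul hq
  -- Stated for general h to serve both f and f + δ_M.
  have hdir : ∀ h : EuclideanSpace ℝ (Fin n) → EReal, (∀ y ∈ M, h y = f y) → (∀ y, f y ≤ h y) →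
      subderivative h x u = 0 := by
    intro h h1 h2
    refine subderivative_eq_zero ((h1 x hxM).trans hfx)
      (hlow.mono fun y hy => hy.trans (h2 y)) ht hvu hr (hMarc.mono fun k hk => ?_)
    rw [h1 _ hk.1, hk.2]
    refine le_of_eq (congrArg _ ?_)
    ring
  have hδM : ∀ y ∈ M, f y + indicatorFn M y = f y := fun y hy => by simp [indicatorFn, hy]
  have hδle : ∀ y, f y ≤ f y + indicatorFn M y := fun y => by
    refine le_add_of_nonneg_right ?_
    unfold indicatorFn
    split_ifs <;> simp
  refine ⟨u, ⟨m, F, hF, hFu⟩, w', by simpa using hε.le, ?_⟩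
  have hupper : parabolicSubderivative (fun y => f y + indicatorFn M y) x u w' ≤
      ((fderiv ℝ (fderiv ℝ φ) x u u : ℝ) : EReal) := by
    refine parabolicSubderivative_le ((hδM x hxM).trans hfx) (hdir _ hδM hδle) ht hws hq
      (hMarc.mono fun k hk => ?_)
    rw [harc, hδM _ hk.1, hk.2]
  refine hupper.trans (le_of_not_gt fun hlt => ?_)
  obtain ⟨c, hc1, hc2⟩ := EReal.lt_iff_exists_real_btwn.1 hlt
  have hfreq := frequently_le_on_identifiableManifold hbot hlsc hM.identification hfx hC hlow
    (frequently_le_of_parabolicSubderivative_lt hfx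
      (hdir f (fun _ _ => rfl) fun _ => le_rfl) hc1)
  have hxp : Tendsto (fun p : ℝ × EuclideanSpace ℝ (Fin n) => x + p.1 • p.2)
      (𝓝[>] (0 : ℝ) ×ˢ 𝓝 u) (𝓝 x) := by
    have h1 : Tendsto (fun p : ℝ × EuclideanSpace ℝ (Fin n) => p.1)
        (𝓝[>] (0 : ℝ) ×ˢ 𝓝 u) (𝓝 0) := tendsto_fst.mono_right nhdsWithin_le_nhds
    simpa using (h1.smul tendsto_snd).const_add x
  obtain ⟨p, hp, hprop⟩ := exists_seq_forall_of_frequently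
    (hfreq.and_eventually ((hxp.eventually (hF.mem_iff.and hfg)).and
      (tendsto_fst.eventually self_mem_nhdsWithin)))
  -- Only the directions need to converge here, so the points found on M need not lie on a parabolic
  -- arc.
  have hlim := tendsto_second_order_quotient hφ.contDiffAt hcrit
    (tendsto_fst.comp hp) (tendsto_snd.comp hp)
  refine absurd (le_of_tendsto hlim (b := c) (Eventually.of_forall fun k => ?_))
    (not_le.2 (by exact_mod_cast hc2))
  obtain ⟨⟨h1, h2⟩, ⟨h3, h4⟩, (h5 : 0 < (p k).1)⟩ := hprop k
  rw [h4 h1, ← hφg _ (h3.1 h1), ← hφx] at h2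
  have h6 : φ (x + (p k).1 • (p k).2) ≤ φ x + c * ((p k).1 ^ 2 / 2) := by exact_mod_cast h2
  simp only [Function.comp]
  rw [div_le_iff₀ (by positivity)]
  linarith
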